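/- Let $\mathcal A$ be a commutative $\mathbb C$-algebra and let $\mathcal C=\mathcal A[[t_1,t_2,\dots]]$ be the ring of formal power series in infinitely many variables $t_n$ ($n=1,2,\dots$). Consider $\mathbb Z\times\mathbb Z$ matrices with entries in $\mathcal C$; let $\Lambda=(\delta_{\mu+1,\nu})_{\mu,\nu\in\mathbb Z}$ be the shift matrix, and for a sequence $a=(a(s))_{s\in\mathbb Z}$ in $\mathcal C$ write $a(s)\Lambda^k$ for the product of the diagonal matrix $\mathrm{diag}_s[a(s)]$ with $\Lambda^k$ ($k\in\mathbb Z$). Derivatives $\partial/\partial t_n$ of matrices are taken entrywise, and $[P,Q]=PQ-QP$. For each $n=1,2,\dots$ let $$B_n=\sum_{j=0}^{n} b^{(n)}_j(s)\,\Lambda^j,\qquad b^{(n)}_j(s)\in\mathcal C,\quad b^{(n)}_n(s)=1 \text{ for all } s\in\mathbb Z,$$ and suppose that the Zakharov--Shabat equations $$\frac{\partial B_m}{\partial t_n}-\frac{\partial B_n}{\partial t_m}+[B_m,B_n]=0$$ hold for all $m,n=1,2,\dots$. Then there exists a matrix $$L=\sum_{j=0}^{\infty}u_{1-j}(s)\,\Lambda^{1-j},\qquad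 u_{1-j}(s)\in\mathcal C,\quad u_1(s)=1 \text{ for all } s\in\mathbb Z,$$ which satisfies the Lax equations $$\frac{\partial L}{\partial t_n}-[B_n,L]=0\qquad\text{for all } n=1,2,\dots.$$ (All matrix products involved have entries given by finite sums.) -/

import Mathlib

/-- The ring `A[[t₁, t₂, …]]` of formal power series in the times `tₙ`, `n = 1, 2, …`. -/
abbrev TimeSeries (A : Type*) : Type _ := MvPowerSeries ℕ+ A

/-- `ℤ × ℤ` matrices with entries in `A[[t₁, t₂, …]]`. -/
abbrev ZMatrix (A : Type*) : Type _ := Matrix ℤ ℤ (TimeSeries A)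

namespace ZMatrix

variable {A : Type*} [CommRing A]

/-- `diag_s[a(s)] Λ ^ k`, where `Λ = (δ_{μ+1,ν})` is the shift matrix: the entry in row `s` and
column `s + k` is `a(s)`, and all other entries vanish. -/
def diagShift (a : ℤ → TimeSeries A) (k : ℤ) : ZMatrix A :=
  Matrix.of fun μ ν => if μ + k = ν then a μ else 0

/-- The infinite sum `∑_{k ≤ N} diag_s[a_k(s)] Λ ^ k`. Each entry of the sum gets a contribution
from at most one `k`, namely `k = ν - μ`. -/
def lowerSeries (N : ℤ) (a : ℤ → ℤ → TimeSeries A) : ZMatrix A :=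
  Matrix.of fun μ ν => if ν - μ ≤ N then a (ν - μ) μ else 0

/-- The product of `ℤ × ℤ` matrices. For matrices `∑_{k ≤ N} a_k(s) Λ ^ k` the sum over the inner
index has finitely many nonzero terms, see `finite_support_mul`. -/
noncomputable def mul (P Q : ZMatrix A) : ZMatrix A :=
  Matrix.of fun μ ν => ∑ᶠ κ : ℤ, P μ κ * Q κ ν

/-- The commutator `[P, Q] = PQ - QP`. -/
noncomputable def comm (P Q : ZMatrix A) : ZMatrix A := mul P Q - mul Q P

/-- The entrywise derivative `∂P/∂tₙ`. -/
noncomputable def timeDeriv (n : ℕ+) (P : ZMatrix A) : ZMatrix A :=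
  P.map (MvPowerSeries.pderiv A n)

theorem finite_support_mul {P Q : ZMatrix A} {M N : ℤ}
    (hP : ∀ μ ν, M < ν - μ → P μ ν = 0) (hQ : ∀ μ ν, N < ν - μ → Q μ ν = 0) (μ ν : ℤ) :
    (Function.support fun κ : ℤ => P μ κ * Q κ ν).Finite := by
  refine (Set.finite_Icc (ν - N) (μ + M)).subset fun κ hκ => ?_
  rw [Function.mem_support] at hκ
  constructor
  · by_contra h
    exact hκ (by rw [hQ κ ν (by omega), mul_zero])
  · by_contra h
    exact hκ (by rw [hP μ κ (by omega), zero_mul])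

end ZMatrix

/-! The Zakharov–Shabat equations say that the connection `∂/∂tₙ - Bₙ` is flat, and a solution `L`
is an operator `Λ + O(1)` that is parallel for it. It is found in a simpler gauge and transported
back.

A gauge transformation `W = 1 + O(Λ⁻¹)` makes every coefficient of nonnegative order independent of
the site `s` (`exists_gauge_constAt`). Order by order, flatness turns the top nonconstant
coefficients into a compatible family of difference equations with a common solution
(`difference_comm_of_isFlat`, `exists_forall_sub_difference_const`). The negative part of the
connection remains arbitrary.

In this gauge `Λ` is parallel up to operators of order at most `0`. Flatness forces such an error to
be site-independent (`isConst_lax`) and its leading coefficients to form a closed family of power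
series, hence a gradient (`exists_forall_pderiv_eq`). Subtracting the potential lowers the order of
the error, and the corrections converge to a parallel `X` (`exists_lax_eq_zero`). Then `L = W X
W⁻¹`. -/

namespace ZMatrix

variable {A : Type*} [CommRing A]

/-! ### The ring of formal difference operators and its order filtration -/

variable (A) in
/-- The ring of formal difference operators `∑_{k ≤ N} a_k(s) Λ ^ k`, realised as matrices with only
finitely many nonzero diagonals above the main one. -/
structure DiffOp where
  /-- The underlying matrix. -/
  val : ZMatrix A
  bounded : ∃ N : ℤ, ∀ μ ν, N < ν - μ → val μ ν = 0

namespace DiffOp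

theorem ext {P Q : DiffOp A} (h : ∀ μ ν, P.1 μ ν = Q.1 μ ν) : P = Q :=
  match P, Q with
  | ⟨_, _⟩, ⟨_, _⟩ => by
    congr
    exact Matrix.ext h

noncomputable instance : Zero (DiffOp A) := ⟨⟨0, 0, fun _ _ _ => rfl⟩⟩

noncomputable instance : Add (DiffOp A) where
  add P Q := ⟨P.1 + Q.1, by
    obtain ⟨M, hM⟩ := P.2
    obtain ⟨N, hN⟩ := Q.2
    refine ⟨max M N, fun μ ν h => ?_⟩
    rw [Matrix.add_apply, hM μ ν (by omega), hN μ ν (by omega), add_zero]⟩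

noncomputable instance : Neg (DiffOp A) where
  neg P := ⟨-P.1, by
    obtain ⟨M, hM⟩ := P.2
    refine ⟨M, fun μ ν h => ?_⟩
    rw [Matrix.neg_apply, hM μ ν h, neg_zero]⟩

@[simp] theorem zero_apply (μ ν : ℤ) : (0 : DiffOp A).1 μ ν = 0 := rfl
@[simp] theorem add_apply (P Q : DiffOp A) (μ ν : ℤ) : (P + Q).1 μ ν = P.1 μ ν + Q.1 μ ν := rfl
@[simp] theorem neg_apply (P : DiffOp A) (μ ν : ℤ) : (-P).1 μ ν = -P.1 μ ν := rfl

noncomputable instance : AddCommGroup (DiffOp A) where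
  add_assoc P Q R := ext fun μ ν => add_assoc (P.1 μ ν) (Q.1 μ ν) (R.1 μ ν)
  zero_add P := ext fun μ ν => zero_add (P.1 μ ν)
  add_zero P := ext fun μ ν => add_zero (P.1 μ ν)
  add_comm P Q := ext fun μ ν => add_comm (P.1 μ ν) (Q.1 μ ν)
  neg_add_cancel P := ext fun μ ν => neg_add_cancel (P.1 μ ν)
  nsmul := nsmulRec
  zsmul := zsmulRec

@[simp] theorem sub_apply (P Q : DiffOp A) (μ ν : ℤ) : (P - Q).1 μ ν = P.1 μ ν - Q.1 μ ν := by
  rw [sub_eq_add_neg, add_apply, neg_apply, ← sub_eq_add_neg]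

variable (A) in
/-- Difference operators of order at most `k`. -/
noncomputable def ordLE (k : ℤ) : AddSubgroup (DiffOp A) where
  carrier := {P | ∀ μ ν, k < ν - μ → P.1 μ ν = 0}
  zero_mem' := fun _ _ _ => rfl
  add_mem' := by
    intro P Q hP hQ μ ν h
    rw [add_apply, hP μ ν h, hQ μ ν h, add_zero]
  neg_mem' := by
    intro P hP μ ν h
    rw [neg_apply, hP μ ν h, neg_zero]

theorem ordLE_mono {k l : ℤ} (h : k ≤ l) {P : DiffOp A} (hP : P ∈ ordLE A k) : P ∈ ordLE A l :=
  fun μ ν hl => hP μ ν (by omega)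

theorem exists_mem_ordLE (P : DiffOp A) : ∃ k, P ∈ ordLE A k := P.2

theorem mul_apply_of_ord {P Q : ZMatrix A} {M N : ℤ}
    (hP : ∀ μ ν, M < ν - μ → P μ ν = 0) (hQ : ∀ μ ν, N < ν - μ → Q μ ν = 0) {μ ν a b : ℤ}
    (ha : a ≤ ν - N) (hb : μ + M ≤ b) :
    ZMatrix.mul P Q μ ν = ∑ κ ∈ Finset.Icc a b, P μ κ * Q κ ν := by
  refine finsum_eq_sum_of_support_subset _ fun κ hκ => ?_
  rw [Function.mem_support] at hκ
  rw [Finset.coe_Icc]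
  constructor
  · by_contra h
    exact hκ (by rw [hQ κ ν (by omega), mul_zero])
  · by_contra h
    exact hκ (by rw [hP μ κ (by omega), zero_mul])

theorem mul_ord {P Q : ZMatrix A} {M N : ℤ}
    (hP : ∀ μ ν, M < ν - μ → P μ ν = 0) (hQ : ∀ μ ν, N < ν - μ → Q μ ν = 0) (μ ν : ℤ)
    (h : M + N < ν - μ) : ZMatrix.mul P Q μ ν = 0 := by
  rw [mul_apply_of_ord hP hQ le_rfl le_rfl, Finset.Icc_eq_empty (by omega), Finset.sum_empty]

noncomputable instance : Mul (DiffOp A) where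
  mul P Q := ⟨ZMatrix.mul P.1 Q.1, by
    obtain ⟨M, hM⟩ := P.2
    obtain ⟨N, hN⟩ := Q.2
    exact ⟨M + N, mul_ord hM hN⟩⟩

theorem val_mul (P Q : DiffOp A) : (P * Q).1 = ZMatrix.mul P.1 Q.1 := rfl

theorem mul_apply {P Q : DiffOp A} {M N : ℤ} (hP : P ∈ ordLE A M) (hQ : Q ∈ ordLE A N)
    {μ ν a b : ℤ} (ha : a ≤ ν - N) (hb : μ + M ≤ b) :
    (P * Q).1 μ ν = ∑ κ ∈ Finset.Icc a b, P.1 μ κ * Q.1 κ ν :=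
  mul_apply_of_ord hP hQ ha hb

theorem mul_mem_ordLE {P Q : DiffOp A} {M N : ℤ} (hP : P ∈ ordLE A M) (hQ : Q ∈ ordLE A N) :
    P * Q ∈ ordLE A (M + N) :=
  mul_ord hP hQ

/-- The operator `diag_s[a(s)] Λ ^ k`. -/
noncomputable def mono (a : ℤ → TimeSeries A) (k : ℤ) : DiffOp A :=
  ⟨diagShift a k, k, fun μ ν h => if_neg (by omega)⟩

theorem mono_apply (a : ℤ → TimeSeries A) (k μ ν : ℤ) :
    (mono a k).1 μ ν = if μ + k = ν then a μ else 0 := rfl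

theorem mono_mem_ordLE (a : ℤ → TimeSeries A) (k : ℤ) : mono a k ∈ ordLE A k :=
  fun μ ν h => if_neg (by omega)

noncomputable instance : One (DiffOp A) := ⟨mono (fun _ => 1) 0⟩

theorem one_apply (μ ν : ℤ) : (1 : DiffOp A).1 μ ν = if μ = ν then 1 else 0 := by
  change (mono (fun _ => 1) 0).1 μ ν = _
  rw [mono_apply, add_zero]

theorem one_mem_ordLE : (1 : DiffOp A) ∈ ordLE A 0 := mono_mem_ordLE _ _

theorem mul_assoc_aux (P Q R : DiffOp A) : P * Q * R = P * (Q * R) := by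
  obtain ⟨l, hP⟩ := P.exists_mem_ordLE
  obtain ⟨m, hQ⟩ := Q.exists_mem_ordLE
  obtain ⟨n, hR⟩ := R.exists_mem_ordLE
  refine ext fun μ ν => ?_
  rw [mul_apply (mul_mem_ordLE hP hQ) hR le_rfl le_rfl,
    mul_apply hP (mul_mem_ordLE hQ hR) le_rfl le_rfl]
  -- The inner ranges are enlarged so as not to depend on the outer index; the double sum can then
  -- be interchanged.
  have h₁ : ∀ κ ∈ Finset.Icc (ν - n) (μ + (l + m)), (P * Q).1 μ κ * R.1 κ ν =
      ∑ i ∈ Finset.Icc (ν - (m + n)) (μ + l), P.1 μ i * Q.1 i κ * R.1 κ ν := by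
    intro κ hκ
    rw [Finset.mem_Icc] at hκ
    rw [mul_apply hP hQ (a := ν - (m + n)) (b := μ + l) (by omega) le_rfl, Finset.sum_mul]
  have h₂ : ∀ i ∈ Finset.Icc (ν - (m + n)) (μ + l), P.1 μ i * (Q * R).1 i ν =
      ∑ κ ∈ Finset.Icc (ν - n) (μ + (l + m)), P.1 μ i * Q.1 i κ * R.1 κ ν := by
    intro i hi
    rw [Finset.mem_Icc] at hi
    rw [mul_apply hQ hR (a := ν - n) (b := μ + (l + m)) le_rfl (by omega), Finset.mul_sum]
    exact Finset.sum_congr rfl fun κ _ => (mul_assoc _ _ _).symm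
  rw [Finset.sum_congr rfl h₁, Finset.sum_congr rfl h₂, Finset.sum_comm]

theorem add_mul_aux (P Q R : DiffOp A) : (P + Q) * R = P * R + Q * R := by
  obtain ⟨l, hP⟩ := P.exists_mem_ordLE
  obtain ⟨m, hQ⟩ := Q.exists_mem_ordLE
  obtain ⟨n, hR⟩ := R.exists_mem_ordLE
  have hP' := ordLE_mono (le_max_left l m) hP
  have hQ' := ordLE_mono (le_max_right l m) hQ
  refine ext fun μ ν => ?_
  rw [add_apply, mul_apply (add_mem hP' hQ') hR le_rfl le_rfl, mul_apply hP' hR le_rfl le_rfl,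
    mul_apply hQ' hR le_rfl le_rfl, ← Finset.sum_add_distrib]
  exact Finset.sum_congr rfl fun κ _ => add_mul (P.1 μ κ) (Q.1 μ κ) (R.1 κ ν)

theorem mul_add_aux (P Q R : DiffOp A) : P * (Q + R) = P * Q + P * R := by
  obtain ⟨l, hP⟩ := P.exists_mem_ordLE
  obtain ⟨m, hQ⟩ := Q.exists_mem_ordLE
  obtain ⟨n, hR⟩ := R.exists_mem_ordLE
  have hQ' := ordLE_mono (le_max_left m n) hQ
  have hR' := ordLE_mono (le_max_right m n) hR
  refine ext fun μ ν => ?_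
  rw [add_apply, mul_apply hP (add_mem hQ' hR') le_rfl le_rfl, mul_apply hP hQ' le_rfl le_rfl,
    mul_apply hP hR' le_rfl le_rfl, ← Finset.sum_add_distrib]
  exact Finset.sum_congr rfl fun κ _ => mul_add (P.1 μ κ) (Q.1 κ ν) (R.1 κ ν)

theorem mono_mul_apply (a : ℤ → TimeSeries A) (k : ℤ) (P : DiffOp A) (μ ν : ℤ) :
    (mono a k * P).1 μ ν = a μ * P.1 (μ + k) ν := by
  rw [val_mul]
  refine (finsum_eq_single _ (μ + k) fun κ hκ => ?_).trans ?_
  · rw [mono_apply, if_neg (Ne.symm hκ), zero_mul]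
  · rw [mono_apply, if_pos rfl]

theorem mul_mono_apply (a : ℤ → TimeSeries A) (k : ℤ) (P : DiffOp A) (μ ν : ℤ) :
    (P * mono a k).1 μ ν = P.1 μ (ν - k) * a (ν - k) := by
  rw [val_mul]
  refine (finsum_eq_single _ (ν - k) fun κ hκ => ?_).trans ?_
  · rw [mono_apply, if_neg (by omega), mul_zero]
  · rw [mono_apply, if_pos (by omega)]

noncomputable instance : Ring (DiffOp A) :=
  { (inferInstance : AddCommGroup (DiffOp A)), (inferInstance : Mul (DiffOp A)),
    (inferInstance : One (DiffOp A)) with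
    mul_assoc := mul_assoc_aux
    left_distrib := mul_add_aux
    right_distrib := add_mul_aux
    zero_mul := fun P => by
      have h := add_mul_aux 0 0 P
      rwa [add_zero, left_eq_add] at h
    mul_zero := fun P => by
      have h := mul_add_aux P 0 0
      rwa [add_zero, left_eq_add] at h
    one_mul := fun P => by
      refine ext fun μ ν => ?_
      exact (mono_mul_apply (fun _ => 1) 0 P μ ν).trans (by rw [one_mul, add_zero])
    mul_one := fun P => by
      refine ext fun μ ν => ?_
      exact (mul_mono_apply (fun _ => 1) 0 P μ ν).trans (by rw [mul_one, sub_zero]) }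

/-- The top coefficient of a product is the twisted product of the top coefficients. -/
theorem mul_apply_top {P Q : DiffOp A} {M N : ℤ} (hP : P ∈ ordLE A M) (hQ : Q ∈ ordLE A N)
    (s : ℤ) :
    (P * Q).1 s (s + (M + N)) = P.1 s (s + M) * Q.1 (s + M) (s + M + N) := by
  rw [mul_apply hP hQ le_rfl le_rfl, show s + (M + N) - N = s + M by ring, Finset.Icc_self,
    Finset.sum_singleton, show s + (M + N) = s + M + N by ring]

theorem commutator_mem_ordLE {P Q : DiffOp A} {M N : ℤ} (hP : P ∈ ordLE A M)
    (hQ : Q ∈ ordLE A N) : P * Q - Q * P ∈ ordLE A (M + N) :=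
  sub_mem (mul_mem_ordLE hP hQ) (add_comm N M ▸ mul_mem_ordLE hQ hP)

/-- The top coefficient of the commutator with a monic operator of order `M` is given by the
`M`-step difference of the top coefficient. -/
theorem commutator_apply_top {P Q : DiffOp A} {M N : ℤ} (hP : P ∈ ordLE A M)
    (hP₁ : ∀ s, P.1 s (s + M) = 1) (hQ : Q ∈ ordLE A N) (s : ℤ) :
    (P * Q - Q * P).1 s (s + (M + N)) = Q.1 (s + M) (s + M + N) - Q.1 s (s + N) := by
  rw [sub_apply, mul_apply_top hP hQ, add_comm M N, mul_apply_top hQ hP, hP₁, hP₁, one_mul,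
    mul_one]

theorem eq_zero_of_forall_mem_ordLE {P : DiffOp A} (c : ℤ)
    (h : ∀ i : ℕ, P ∈ ordLE A (c - i)) : P = 0 := by
  refine ext fun μ ν => ?_
  exact h (c - (ν - μ) + 1).toNat μ ν (by omega)

/-- Completeness of the order filtration. -/
theorem exists_limit (f : ℕ → DiffOp A)
    (hf : ∀ i : ℕ, f (i + 1) - f i ∈ ordLE A (-i)) :
    ∃ P : DiffOp A, ∀ i : ℕ, P - f i ∈ ordLE A (-i) := by
  have hle : ∀ i j : ℕ, i ≤ j → f j - f i ∈ ordLE A (-i) := by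
    intro i j hij
    induction j, hij using Nat.le_induction with
    | base => rw [sub_self]; exact zero_mem _
    | succ j hij ih =>
      rw [← sub_add_sub_cancel (f (j + 1)) (f j)]
      exact add_mem (ordLE_mono (by omega) (hf j)) ih
  have key : ∀ (i : ℕ) (μ ν : ℤ), (-i : ℤ) < ν - μ →
      (f (μ - ν + 1).toNat).1 μ ν = (f i).1 μ ν := by
    intro i μ ν h
    have := hle (μ - ν + 1).toNat i (by omega) μ ν (by omega)
    rw [sub_apply, sub_eq_zero] at this
    exact this.symm
  obtain ⟨N, hN⟩ := (f 0).exists_mem_ordLE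
  -- The diagonal `ν - μ` no longer changes once the index exceeds `μ - ν`. Diagonals above the main
  -- one are already those of `f 0`, which bounds the limit.
  refine ⟨⟨Matrix.of fun μ ν => (f (μ - ν + 1).toNat).1 μ ν, max N 0, fun μ ν h => ?_⟩,
    fun i μ ν h => ?_⟩
  · exact (key 0 μ ν (by push_cast; omega)).trans (hN μ ν (by omega))
  · rw [sub_apply, sub_eq_zero]
    exact key i μ ν h

theorem pow_mem_ordLE {P : DiffOp A} (hP : P ∈ ordLE A (-1)) (i : ℕ) : P ^ i ∈ ordLE A (-i) := by
  induction i with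
  | zero => rw [pow_zero]; exact one_mem_ordLE
  | succ i ih =>
    rw [pow_succ]
    exact ordLE_mono (by push_cast; omega) (mul_mem_ordLE ih hP)

/-- Operators of the form `1 + O(Λ⁻¹)` are invertible, with inverse of the same form. -/
theorem exists_unit_of_sub_one_mem {P : DiffOp A} (hP : P - 1 ∈ ordLE A (-1)) :
    ∃ W : (DiffOp A)ˣ, (W : DiffOp A) = P ∧
      ((W⁻¹ : (DiffOp A)ˣ) : DiffOp A) - 1 ∈ ordLE A (-1) := by
  have hN : 1 - P ∈ ordLE A (-1) := by
    rw [← neg_sub]; exact neg_mem hP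
  have hP0 : P ∈ ordLE A 0 := by
    have := add_mem (ordLE_mono (by norm_num) hP) (one_mem_ordLE (A := A))
    rwa [sub_add_cancel] at this
  -- Neumann series for the inverse of `P = 1 - (1 - P)`.
  obtain ⟨Q, hQ⟩ := exists_limit (fun i => ∑ k ∈ Finset.range i, (1 - P) ^ k) fun i => by
    rw [Finset.sum_range_succ, add_sub_cancel_left]
    exact pow_mem_ordLE hN i
  have hPQ : P * Q = 1 := by
    rw [← sub_eq_zero]
    refine eq_zero_of_forall_mem_ordLE 0 fun i => ?_
    have h₁ := mul_mem_ordLE hP0 (hQ i)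
    have h₂ := mul_neg_geom_sum (1 - P) i
    rw [sub_sub_cancel] at h₂
    rw [mul_sub, h₂] at h₁
    have h₃ := sub_mem h₁ (ordLE_mono (by omega) (pow_mem_ordLE hN i) :
      (1 - P) ^ i ∈ ordLE A (0 + -i))
    rwa [sub_sub, sub_add_cancel, zero_add, ← zero_sub] at h₃
  have hQP : Q * P = 1 := by
    rw [← sub_eq_zero]
    refine eq_zero_of_forall_mem_ordLE 0 fun i => ?_
    have h₁ := mul_mem_ordLE (hQ i) hP0
    have h₂ := geom_sum_mul_neg (1 - P) i
    rw [sub_sub_cancel] at h₂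
    rw [sub_mul, h₂] at h₁
    have h₃ := sub_mem h₁ (ordLE_mono (by omega) (pow_mem_ordLE hN i) :
      (1 - P) ^ i ∈ ordLE A (-i + 0))
    rwa [sub_sub, sub_add_cancel, add_zero, ← zero_sub] at h₃
  refine ⟨⟨P, Q, hPQ, hQP⟩, rfl, ?_⟩
  have := hQ 1
  rw [Finset.sum_range_one, pow_zero] at this
  exact_mod_cast this

end DiffOp
end ZMatrix

/-! ### Integration of power series and of difference equations -/

namespace ZMatrix

variable {A : Type*} [CommRing A]

theorem pderiv_comm (m n : ℕ+) (f : TimeSeries A) :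
    MvPowerSeries.pderiv A m (MvPowerSeries.pderiv A n f) =
      MvPowerSeries.pderiv A n (MvPowerSeries.pderiv A m f) := by
  rcases eq_or_ne m n with rfl | h
  · rfl
  ext d
  simp only [MvPowerSeries.coeff_pderiv, Finsupp.add_apply, Finsupp.single_apply, if_neg h,
    if_neg h.symm, add_zero]
  rw [add_right_comm, mul_right_comm]

/-- The formal Poincaré lemma: a closed family of power series is a gradient. -/
theorem exists_forall_pderiv_eq [Algebra ℂ A] (r : ℕ+ → TimeSeries A)
    (hr : ∀ m n, MvPowerSeries.pderiv A m (r n) = MvPowerSeries.pderiv A n (r m)) :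
    ∃ ρ : TimeSeries A, ∀ n, MvPowerSeries.pderiv A n ρ = r n := by
  classical
  -- Each monomial is integrated along an arbitrarily chosen variable occurring in it, dividing by
  -- its exponent; closedness makes the choice immaterial.
  let ρ : TimeSeries A := fun d =>
    if h : ∃ n, d n ≠ 0 then
      ((d h.choose : ℂ)⁻¹) •
        MvPowerSeries.coeff (d - Finsupp.single h.choose 1) (r h.choose)
    else 0
  refine ⟨ρ, fun n => ?_⟩
  ext d
  rw [MvPowerSeries.coeff_pderiv]
  have h : ∃ n', (d + Finsupp.single n 1 : ℕ+ →₀ ℕ) n' ≠ 0 := ⟨n, by simp⟩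
  have hρ : MvPowerSeries.coeff (d + Finsupp.single n 1) ρ =
      (((d + Finsupp.single n 1 : ℕ+ →₀ ℕ) h.choose : ℂ)⁻¹) •
        MvPowerSeries.coeff (d + Finsupp.single n 1 - Finsupp.single h.choose 1)
          (r h.choose) := dif_pos h
  rw [hρ]
  have hm := h.choose_spec
  generalize h.choose = m at hm
  rcases eq_or_ne m n with rfl | hmn
  · rw [add_tsub_cancel_right, smul_mul_assoc, inv_smul_eq_iff₀ (by exact_mod_cast hm),
      Algebra.smul_def, mul_comm]
    simp
  · have hdm : d m ≠ 0 := by simpa [Finsupp.single_apply, hmn.symm] using hm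
    obtain ⟨e, rfl⟩ : ∃ e : ℕ+ →₀ ℕ, d = e + Finsupp.single m 1 :=
      ⟨d - Finsupp.single m 1, (tsub_add_cancel_of_le
        (Finsupp.single_le_iff.2 (Nat.one_le_iff_ne_zero.2 hdm))).symm⟩
    have hc := congrArg (MvPowerSeries.coeff e) (hr m n)
    rw [MvPowerSeries.coeff_pderiv, MvPowerSeries.coeff_pderiv] at hc
    rw [add_right_comm, add_tsub_cancel_right, smul_mul_assoc,
      inv_smul_eq_iff₀ (by exact_mod_cast (show _ ≠ 0 by simp)), Algebra.smul_def, mul_comm _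
        (MvPowerSeries.coeff _ (r n))]
    simpa [Finsupp.single_apply, hmn, hmn.symm] using hc.symm

theorem exists_antidifference {M : Type*} [AddCommGroup M] (g : ℤ → M) :
    ∃ h : ℤ → M, ∀ s, h (s + 1) - h s = g s := by
  refine ⟨fun s => ∑ i ∈ Finset.Ico 0 s, g i - ∑ i ∈ Finset.Ico s 0, g i, fun s => ?_⟩
  rcases le_or_gt 0 s with hs | hs
  · have h₁ : Finset.Ico 0 (s + 1) = insert s (Finset.Ico 0 s) := by
      ext i; simp only [Finset.mem_Ico, Finset.mem_insert]; omega
    have h₂ : Finset.Ico (s + 1) 0 = ∅ := Finset.Ico_eq_empty (by omega)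
    have h₃ : Finset.Ico s 0 = ∅ := Finset.Ico_eq_empty (by omega)
    simp only [h₁, h₂, h₃]
    rw [Finset.sum_insert (by simp)]
    simp
  · have h₁ : Finset.Ico s 0 = insert s (Finset.Ico (s + 1) 0) := by
      ext i; simp only [Finset.mem_Ico, Finset.mem_insert]; omega
    have h₂ : Finset.Ico 0 (s + 1) = ∅ := Finset.Ico_eq_empty (by omega)
    have h₃ : Finset.Ico 0 s = ∅ := Finset.Ico_eq_empty (by omega)
    simp only [h₁, h₂, h₃]
    rw [Finset.sum_insert (by simp)]
    simp

/-- Periods `j` and `j + 1` together give period `1`. -/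
theorem eq_apply_zero_of_shift {M : Type*} {f : ℤ → M} {j : ℤ} (h₁ : ∀ s, f (s + j) = f s)
    (h₂ : ∀ s, f (s + (j + 1)) = f s) (s : ℤ) : f s = f 0 := by
  have h : ∀ s, f (s + 1) = f s := fun s => by
    rw [← h₁, ← h₂ s]; congr 1; ring
  induction s using Int.induction_on with
  | zero => rfl
  | succ i ih => rw [h, ih]
  | pred i ih => rw [← ih, ← h (-i - 1)]; congr 1; ring

/-- A compatible family of functions on `ℤ` is, up to constants, a family of differences of a single
function. -/
theorem exists_forall_sub_difference_const {M : Type*} [AddCommGroup M] (a : ℕ → ℤ → M) (j : ℕ)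
    (ha : ∀ m n, j ≤ m → j ≤ n → ∀ s, a n (s + m) - a n s = a m (s + n) - a m s) :
    ∃ h : ℤ → M, ∀ n, j ≤ n → ∀ s, a n s - (h (s + n) - h s) = a n 0 - (h (0 + n) - h 0) := by
  -- The shift by `j` makes the corrected functions `u (j + 1)` and `u j` coincide. Compatibility of
  -- this pair makes `u j` constant, and then every `u n` has periods `j` and `j + 1`.
  obtain ⟨h, hh⟩ := exists_antidifference fun s => a (j + 1) (s - j) - a j (s - j)
  refine ⟨h, ?_⟩
  let u : ℕ → ℤ → M := fun n s => a n s - (h (s + n) - h s)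
  have hu : ∀ m n, j ≤ m → j ≤ n → ∀ s, u n (s + m) - u n s = u m (s + n) - u m s := by
    intro m n hm hn s
    have := ha m n hm hn s
    simp only [u]
    rw [add_right_comm s (m : ℤ) n, sub_sub_sub_comm, this]
    abel
  have hj : u (j + 1) = u j := by
    funext s
    have := hh (s + j)
    rw [add_sub_cancel_right] at this
    simp only [u]
    rw [sub_eq_sub_iff_sub_eq_sub, ← this]
    push_cast
    rw [← add_assoc]
    abel
  have hu0 : ∀ s, u j s = u j 0 := by
    have h1 : ∀ s, u j (s + j + 1) = u j (s + j) := fun s => by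
      have := hu (j + 1) j (by omega) le_rfl s
      rw [hj] at this
      push_cast at this
      rw [← add_assoc] at this
      exact sub_left_injective this
    refine eq_apply_zero_of_shift (j := 0) (fun s => by rw [add_zero]) fun s => ?_
    have := h1 (s - j)
    rwa [sub_add_cancel, ← zero_add (1 : ℤ)] at this
  intro n hn
  refine eq_apply_zero_of_shift (f := u n) (j := j) (fun s => ?_) fun s => ?_
  · have := hu j n le_rfl hn s
    rwa [hu0 (s + n), hu0 s, sub_self, sub_eq_zero] at this
  · have := hu (j + 1) n (by omega) hn s
    rw [hj, hu0 (s + n), hu0 s, sub_self, sub_eq_zero] at this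
    exact_mod_cast this

/-! ### Time derivatives and site-independent operators -/

namespace DiffOp

/-- The derivative `∂/∂tₙ` of difference operators. -/
noncomputable def deriv (n : ℕ+) : DiffOp A →+ DiffOp A where
  toFun P := ⟨timeDeriv n P.1, by
    obtain ⟨N, hN⟩ := P.2
    exact ⟨N, fun μ ν h => by
      rw [timeDeriv, Matrix.map_apply, hN μ ν h, map_zero]⟩⟩
  map_zero' := ext fun μ ν => map_zero (MvPowerSeries.pderiv A n)
  map_add' P Q := ext fun μ ν => map_add (MvPowerSeries.pderiv A n) (P.1 μ ν) (Q.1 μ ν)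

theorem deriv_apply (n : ℕ+) (P : DiffOp A) (μ ν : ℤ) :
    (deriv n P).1 μ ν = MvPowerSeries.pderiv A n (P.1 μ ν) := rfl

theorem deriv_mem_ordLE {n : ℕ+} {P : DiffOp A} {k : ℤ} (hP : P ∈ ordLE A k) :
    deriv n P ∈ ordLE A k := fun μ ν h => by
  rw [deriv_apply, hP μ ν h, map_zero]

theorem deriv_mul (n : ℕ+) (P Q : DiffOp A) :
    deriv n (P * Q) = deriv n P * Q + P * deriv n Q := by
  obtain ⟨M, hP⟩ := P.exists_mem_ordLE
  obtain ⟨N, hQ⟩ := Q.exists_mem_ordLE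
  refine ext fun μ ν => ?_
  rw [deriv_apply, add_apply, mul_apply hP hQ le_rfl le_rfl,
    mul_apply (deriv_mem_ordLE hP) hQ le_rfl le_rfl,
    mul_apply hP (deriv_mem_ordLE hQ) le_rfl le_rfl, map_sum, ← Finset.sum_add_distrib]
  refine Finset.sum_congr rfl fun κ _ => ?_
  rw [Derivation.leibniz, smul_eq_mul, smul_eq_mul, deriv_apply, deriv_apply, add_comm, mul_comm
    (Q.1 κ ν)]

theorem deriv_one (n : ℕ+) : deriv n (1 : DiffOp A) = 0 := by
  have h := deriv_mul n (1 : DiffOp A) 1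
  rwa [mul_one, mul_one, one_mul, left_eq_add] at h

theorem deriv_comm (m n : ℕ+) (P : DiffOp A) : deriv m (deriv n P) = deriv n (deriv m P) :=
  ext fun _ _ => pderiv_comm m n _

/-- The coefficient of `Λ ^ k` does not depend on the site `s`. -/
def ConstAt (P : DiffOp A) (k : ℤ) : Prop := ∀ s, P.1 s (s + k) = P.1 0 k

/-- All coefficients are independent of the site, i.e. the operator commutes with `Λ`. -/
def IsConst (P : DiffOp A) : Prop := ∀ μ ν, P.1 μ ν = P.1 0 (ν - μ)

theorem isConst_iff_constAt {P : DiffOp A} : IsConst P ↔ ∀ k, ConstAt P k := by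
  refine ⟨fun h k s => ?_, fun h μ ν => ?_⟩
  · rw [h, add_sub_cancel_left]
  · rw [← h (ν - μ) μ, add_sub_cancel]

theorem isConst_mono (c : TimeSeries A) (k : ℤ) : IsConst (mono (fun _ => c) k) := by
  intro μ ν
  rw [mono_apply, mono_apply]
  congr 1
  rw [eq_iff_iff]
  omega

theorem IsConst.sub {P Q : DiffOp A} (hP : IsConst P) (hQ : IsConst Q) : IsConst (P - Q) := by
  intro μ ν
  rw [sub_apply, sub_apply, hP, hQ]

/-- Such operators are Laurent series in `Λ⁻¹` with scalar coefficients; the reflection `κ ↦ μ + ν -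
κ` exchanges the two factors. -/
theorem IsConst.mul_comm {P Q : DiffOp A} (hP : IsConst P) (hQ : IsConst Q) :
    P * Q = Q * P := by
  obtain ⟨M, hM⟩ := P.exists_mem_ordLE
  obtain ⟨N, hN⟩ := Q.exists_mem_ordLE
  refine ext fun μ ν => ?_
  rw [mul_apply hM hN le_rfl le_rfl, mul_apply hN hM le_rfl le_rfl]
  refine Finset.sum_nbij' (fun κ => μ + ν - κ) (fun κ => μ + ν - κ) ?_ ?_ ?_ ?_ ?_
  · intro κ hκ
    rw [Finset.mem_Icc] at hκ ⊢
    omega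
  · intro κ hκ
    rw [Finset.mem_Icc] at hκ ⊢
    omega
  · intro κ _; ring
  · intro κ _; ring
  · intro κ _
    rw [hP μ κ, hQ κ ν, hQ μ (μ + ν - κ), hP (μ + ν - κ) ν, _root_.mul_comm,
      show μ + ν - κ - μ = ν - κ by ring, show ν - (μ + ν - κ) = κ - μ by ring]

/-- The operator `∑_{k ≥ q} a_k(0) Λ ^ k` obtained from `∑_k a_k(s) Λ ^ k`. -/
noncomputable def constPart (P : DiffOp A) (q : ℤ) : DiffOp A :=
  ⟨Matrix.of fun μ ν => if q ≤ ν - μ then P.1 0 (ν - μ) else 0, by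
    obtain ⟨N, hN⟩ := P.2
    refine ⟨N, fun μ ν h => ?_⟩
    rw [Matrix.of_apply, hN 0 (ν - μ) (by omega), ite_self]⟩

theorem constPart_apply (P : DiffOp A) (q μ ν : ℤ) :
    (constPart P q).1 μ ν = if q ≤ ν - μ then P.1 0 (ν - μ) else 0 := rfl

theorem isConst_constPart (P : DiffOp A) (q : ℤ) : IsConst (constPart P q) := by
  intro μ ν
  rw [constPart_apply, constPart_apply, sub_zero]

theorem constPart_mem_ordLE {P : DiffOp A} {N : ℤ} (hP : P ∈ ordLE A N) (q : ℤ) :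
    constPart P q ∈ ordLE A N := by
  intro μ ν h
  rw [constPart_apply, hP 0 (ν - μ) (by omega), ite_self]

theorem sub_constPart_mem_ordLE {P : DiffOp A} {q r : ℤ} (hr : q ≤ r + 1)
    (h : ∀ k, q ≤ k → ConstAt P k) :
    P - constPart P q ∈ ordLE A r := by
  intro μ ν hμν
  rw [sub_apply, constPart_apply, if_pos (by omega), ← h (ν - μ) (by omega) μ, add_sub_cancel,
    sub_self]

theorem constPart_apply_of_le {P : DiffOp A} {q k : ℤ} (hk : q ≤ k) (s : ℤ) :
    (constPart P q).1 s (s + k) = P.1 0 k := by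
  rw [constPart_apply, add_sub_cancel_left, if_pos hk]

theorem sub_constPart_apply_of_lt {P : DiffOp A} {q k : ℤ} (hk : k < q) (s : ℤ) :
    (P - constPart P q).1 s (s + k) = P.1 s (s + k) := by
  rw [sub_apply, constPart_apply, add_sub_cancel_left, if_neg (by omega), sub_zero]

/-- An operator whose commutators with constant monic operators of all orders have bounded order
is itself constant. -/
theorem isConst_of_commutator_mem_ordLE {c : ℕ+ → DiffOp A} (hc : ∀ m, IsConst (c m))
    (hcm : ∀ m : ℕ+, c m ∈ ordLE A (m : ℤ)) (hc₁ : ∀ (m : ℕ+) s, (c m).1 s (s + (m : ℤ)) = 1)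
    {Y : DiffOp A} {n : ℤ} (hY : ∀ m, c m * Y - Y * c m ∈ ordLE A n) : IsConst Y := by
  obtain ⟨N, hN⟩ := Y.exists_mem_ordLE
  have key : ∀ i : ℕ, ∀ k : ℤ, N - i < k → ConstAt Y k := by
    intro i
    induction i with
    | zero =>
      intro k hk s
      rw [hN s (s + k) (by push_cast at hk; omega), hN 0 k (by push_cast at hk; omega)]
    | succ i ih =>
      intro k hk
      rcases lt_or_ge (N - i) k with h | h
      · exact ih k h
      obtain rfl : k = N - i := by push_cast at hk; omega
      have hD : Y - constPart Y (N - i + 1) ∈ ordLE A (N - i) :=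
        sub_constPart_mem_ordLE le_rfl fun k hk => ih k (by omega)
      -- The coefficients above order `N - i` are constant and commute with `c m`. The rest
      -- contributes an `m`-step difference at order `m + (N - i)`, which vanishes once this exceeds
      -- `n`.
      have hper : ∀ m : ℕ+, n < m + (N - i) → ∀ s : ℤ,
          Y.1 (s + m) (s + m + (N - i)) = Y.1 s (s + (N - i)) := by
        intro m hm s
        have h₁ := commutator_apply_top (hcm m) (hc₁ m) hD s
        have h₂ : c m * (Y - constPart Y (N - i + 1)) - (Y - constPart Y (N - i + 1)) * c m =
            c m * Y - Y * c m := by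
          rw [mul_sub, sub_mul, (hc m).mul_comm (isConst_constPart Y (N - i + 1))]
          abel
        rw [h₂, hY m s _ (by omega), sub_constPart_apply_of_lt (by omega),
          sub_constPart_apply_of_lt (by omega)] at h₁
        exact (sub_eq_zero.1 h₁.symm)
      intro s
      -- Large enough for both `j` and `j + 1` to be periods, and positive.
      let j : ℕ := (n - (N - i)).toNat + 1
      have h := eq_apply_zero_of_shift (f := fun s => Y.1 s (s + (N - i))) (j := j)
        (fun s => hper ⟨j, by omega⟩ (by simp only [PNat.mk_coe]; omega) s)
        (fun s => by
          have := hper ⟨j + 1, by omega⟩ (by simp only [PNat.mk_coe]; omega) s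
          simp only [PNat.mk_coe] at this
          exact_mod_cast this) s
      simpa using h
  exact isConst_iff_constAt.2 fun k => key (N - k + 1).toNat k (by omega)

end DiffOp
end ZMatrix

/-! ### Gauging the nonnegative part to constant coefficients -/

namespace ZMatrix

theorem exists_seq_of_step {α : Type*} (P : ℕ → α → Prop) (r : ℕ → α → α → Prop) {a : α}
    (ha : P 0 a) (h : ∀ i a, P i a → ∃ b, P (i + 1) b ∧ r i a b) :
    ∃ f : ℕ → α, (∀ i, P i (f i)) ∧ ∀ i, r i (f i) (f (i + 1)) := by
  choose! g hg using h
  let f : ℕ → α := fun i => Nat.rec a g i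
  have hf : ∀ i, P i (f i) := fun i => by
    induction i with
    | zero => exact ha
    | succ i ih => exact (hg i _ ih).1
  exact ⟨f, hf, fun i => (hg i _ (hf i)).2⟩

namespace DiffOp

variable {A : Type*} [CommRing A]

/-- The zero curvature equations for the connection `∂/∂tₙ - Cₙ`. -/
def IsFlat (C : ℕ+ → DiffOp A) : Prop :=
  ∀ m n, deriv n (C m) - deriv m (C n) + (C m * C n - C n * C m) = 0

/-- `Cₙ` is monic of order `n` for all `n`. -/
structure IsMonic (C : ℕ+ → DiffOp A) : Prop where
  mem (n : ℕ+) : C n ∈ ordLE A (n : ℤ)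
  top (n : ℕ+) (s : ℤ) : (C n).1 s (s + (n : ℤ)) = 1

/-- The gauge transformation `W⁻¹ (∂/∂tₙ - Cₙ) W = ∂/∂tₙ - C'ₙ`. -/
noncomputable def gauge (W : (DiffOp A)ˣ) (C : ℕ+ → DiffOp A) (n : ℕ+) : DiffOp A :=
  ((W⁻¹ : (DiffOp A)ˣ) : DiffOp A) * (C n * W - deriv n (W : DiffOp A))

theorem mul_gauge (W : (DiffOp A)ˣ) (C : ℕ+ → DiffOp A) (n : ℕ+) :
    (W : DiffOp A) * gauge W C n = C n * W - deriv n (W : DiffOp A) := by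
  rw [gauge, Units.mul_inv_cancel_left]

theorem deriv_eq_mul_gauge (W : (DiffOp A)ˣ) (C : ℕ+ → DiffOp A) (n : ℕ+) :
    deriv n (W : DiffOp A) = C n * W - W * gauge W C n := by
  rw [mul_gauge, sub_sub_cancel]

theorem gauge_gauge (W V : (DiffOp A)ˣ) (C : ℕ+ → DiffOp A) :
    gauge V (gauge W C) = gauge (W * V) C := by
  funext n
  have h : ((W * V : (DiffOp A)ˣ) : DiffOp A) * gauge V (gauge W C) n =
      ((W * V : (DiffOp A)ˣ) : DiffOp A) * gauge (W * V) C n := by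
    rw [mul_gauge, Units.val_mul, deriv_mul, mul_assoc, mul_gauge, mul_sub, ← mul_assoc, mul_gauge]
    noncomm_ring
  exact (Units.mul_right_inj _).1 h

/-- Curvature transforms by conjugation: `W` times the new curvature is the old curvature times `W`.
-/
theorem IsFlat.gauge {C : ℕ+ → DiffOp A} (hC : IsFlat C) (W : (DiffOp A)ˣ) :
    IsFlat (gauge W C) := by
  intro m n
  have h : ∀ m n, (W : DiffOp A) * deriv n (DiffOp.gauge W C m) =
      deriv n (C m) * W + C m * deriv n (W : DiffOp A) - deriv n (deriv m (W : DiffOp A)) -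
        deriv n (W : DiffOp A) * DiffOp.gauge W C m := by
    intro m n
    rw [eq_sub_iff_add_eq, add_comm, ← deriv_mul, mul_gauge, map_sub, deriv_mul]
  have h' : ∀ m n, (W : DiffOp A) * (DiffOp.gauge W C m * DiffOp.gauge W C n) =
      C m * (C n * W - deriv n (W : DiffOp A)) -
        deriv m (W : DiffOp A) * DiffOp.gauge W C n := by
    intro m n
    rw [← mul_assoc, mul_gauge, sub_mul, mul_assoc, mul_gauge]
  have hz : (W : DiffOp A) * (deriv n (DiffOp.gauge W C m) - deriv m (DiffOp.gauge W C n) +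
      (DiffOp.gauge W C m * DiffOp.gauge W C n - DiffOp.gauge W C n * DiffOp.gauge W C m)) =
      (deriv n (C m) - deriv m (C n) + (C m * C n - C n * C m)) * W := by
    rw [mul_add, mul_sub, mul_sub, h, h, h', h', deriv_comm n m]
    noncomm_ring
  rw [hC m n, zero_mul] at hz
  exact (Units.mul_right_eq_zero W).1 hz

/-- Only `W - 1` enters the correction, so its order and top coefficient can be read off. -/
theorem gauge_eq_add (W : (DiffOp A)ˣ) (C : ℕ+ → DiffOp A) (n : ℕ+) :
    gauge W C n = C n + ((W⁻¹ : (DiffOp A)ˣ) : DiffOp A) *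
      (C n * ((W : DiffOp A) - 1) - ((W : DiffOp A) - 1) * C n - deriv n ((W : DiffOp A) - 1)) := by
  rw [← Units.mul_right_inj W, mul_gauge, mul_add, Units.mul_inv_cancel_left, map_sub, deriv_one]
  noncomm_ring

theorem inv_sub_one_mem_ordLE {W : (DiffOp A)ˣ} (hW : (W : DiffOp A) - 1 ∈ ordLE A (-1)) :
    ((W⁻¹ : (DiffOp A)ˣ) : DiffOp A) - 1 ∈ ordLE A (-1) := by
  obtain ⟨V, hV, h⟩ := exists_unit_of_sub_one_mem hW
  rwa [Units.ext hV] at h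

theorem mem_ordLE_zero_of_sub_one_mem {P : DiffOp A} (hP : P - 1 ∈ ordLE A (-1)) :
    P ∈ ordLE A 0 := by
  have := add_mem (ordLE_mono (by norm_num) hP) (one_mem_ordLE (A := A))
  rwa [sub_add_cancel] at this

theorem apply_self_of_sub_one_mem {P : DiffOp A} (hP : P - 1 ∈ ordLE A (-1)) (s : ℤ) :
    P.1 s (s + 0) = 1 := by
  have := hP s (s + 0) (by omega)
  rwa [sub_apply, one_apply, if_pos (by ring), sub_eq_zero] at this

theorem gauge_sub_mem_ordLE {C : ℕ+ → DiffOp A} (hC : IsMonic C) {W : (DiffOp A)ˣ} {j : ℤ}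
    (hj : 1 ≤ j) (hW : (W : DiffOp A) - 1 ∈ ordLE A (-j)) (n : ℕ+) :
    gauge W C n - C n ∈ ordLE A (n - j) := by
  have hW' := inv_sub_one_mem_ordLE (ordLE_mono (by omega) hW)
  have hn := n.pos
  rw [gauge_eq_add, add_sub_cancel_left]
  refine ordLE_mono (by omega) (mul_mem_ordLE (mem_ordLE_zero_of_sub_one_mem hW') (sub_mem
    (commutator_mem_ordLE (hC.mem n) hW) (ordLE_mono (by omega) (deriv_mem_ordLE hW))))

theorem gauge_sub_apply_top {C : ℕ+ → DiffOp A} (hC : IsMonic C) {W : (DiffOp A)ˣ} {j : ℤ}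
    (hj : 1 ≤ j) (hW : (W : DiffOp A) - 1 ∈ ordLE A (-j)) (n : ℕ+) (s : ℤ) :
    (gauge W C n - C n).1 s (s + (n - j)) =
      (W - 1 : DiffOp A).1 (s + n) (s + n - j) - (W - 1 : DiffOp A).1 s (s - j) := by
  have hW' := inv_sub_one_mem_ordLE (ordLE_mono (by omega) hW)
  have hn := n.pos
  have h₁ := commutator_mem_ordLE (hC.mem n) hW
  have h₂ : deriv n ((W : DiffOp A) - 1) ∈ ordLE A (n + -j) :=
    ordLE_mono (by omega) (deriv_mem_ordLE hW)
  have h₃ := mul_apply_top (mem_ordLE_zero_of_sub_one_mem hW') (sub_mem h₁ h₂) s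
  rw [apply_self_of_sub_one_mem hW', one_mul, add_zero, sub_apply _ (deriv n _), zero_add,
    deriv_mem_ordLE hW s (s + (n + -j)) (by omega),
    commutator_apply_top (hC.mem n) (hC.top n) hW, sub_zero] at h₃
  rw [gauge_eq_add, add_sub_cancel_left]
  exact h₃

theorem IsMonic.gauge {C : ℕ+ → DiffOp A} (hC : IsMonic C) {W : (DiffOp A)ˣ}
    (hW : (W : DiffOp A) - 1 ∈ ordLE A (-1)) : IsMonic (gauge W C) where
  mem n := by
    have := add_mem (ordLE_mono (by omega) (gauge_sub_mem_ordLE hC le_rfl hW n)) (hC.mem n)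
    rwa [sub_add_cancel] at this
  top n s := by
    have := gauge_sub_mem_ordLE hC le_rfl hW n s (s + n) (by omega)
    rwa [sub_apply, hC.top, sub_eq_zero] at this

theorem IsMonic.deriv_apply_eq_zero {C : ℕ+ → DiffOp A} (hC : IsMonic C) (m n : ℕ+) {k : ℤ}
    (hk : n ≤ k) (s : ℤ) : (deriv m (C n)).1 s (s + k) = 0 := by
  rcases hk.eq_or_lt with rfl | hk
  · rw [deriv_apply, hC.top, Derivation.map_one_eq_zero]
  · exact deriv_mem_ordLE (hC.mem n) s _ (by omega)

/-- The coefficients of `Cₙ` of orders `n, n - 1, …, n - j + 1` that are nonnegative do not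
depend on the site. -/
def ConstUpTo (C : ℕ+ → DiffOp A) (j : ℕ) : Prop :=
  ∀ (n : ℕ+) (i : ℕ), i < j → i ≤ (n : ℕ) → ConstAt (C n) (n - i)

theorem ConstUpTo.constAt {C : ℕ+ → DiffOp A} {j : ℕ} (hC : IsMonic C) (h : ConstUpTo C j)
    {n : ℕ+} {k : ℤ} (hk : 0 ≤ k) (hk' : (n : ℤ) - j + 1 ≤ k) : ConstAt (C n) k := by
  rcases lt_or_ge (n : ℤ) k with hn | hn
  · intro s
    rw [hC.mem n s (s + k) (by omega), hC.mem n 0 k (by omega)]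
  · have := h n (n - k).toNat (by omega) (by omega)
    rwa [show (n : ℤ) - (n - k).toNat = k by omega] at this

/-- Zero curvature in the highest order in which nonconstant coefficients contribute. -/
theorem difference_comm_of_isFlat {C : ℕ+ → DiffOp A} (hf : IsFlat C) (hC : IsMonic C) {j : ℕ}
    (hj : 1 ≤ j) (h : ConstUpTo C j) {m n : ℕ+} (hm : j ≤ (m : ℕ)) (hn : j ≤ (n : ℕ)) (s : ℤ) :
    (C n).1 (s + m) (s + m + (n - j)) - (C n).1 s (s + (n - j)) =
      (C m).1 (s + n) (s + n + (m - j)) - (C m).1 s (s + (m - j)) := by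
  have hD : ∀ n : ℕ+, j ≤ (n : ℕ) → C n - constPart (C n) (n - j + 1) ∈ ordLE A (n - j) :=
    fun n hn => sub_constPart_mem_ordLE le_rfl fun k hk => h.constAt hC (by omega) hk
  have hK : ∀ n : ℕ+, constPart (C n) (n - j + 1) ∈ ordLE A n := fun n =>
    constPart_mem_ordLE (hC.mem n) _
  have hK₁ : ∀ (n : ℕ+) (s : ℤ), (constPart (C n) (n - j + 1)).1 s (s + n) = 1 := fun n s => by
    have := hC.top n 0
    rw [zero_add] at this
    rw [constPart_apply_of_le (by omega), this]
  have hKK := (isConst_constPart (C m) (m - j + 1)).mul_comm (isConst_constPart (C n) (n - j + 1))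
  have hDn := hD n hn
  have hDm := hD m hm
  have h₁ := commutator_apply_top (hK m) (hK₁ m) hDn s
  have h₂ := commutator_apply_top (hK n) (hK₁ n) hDm s
  have h₃ := commutator_mem_ordLE hDm hDn
  -- Write `C = K + D` with `K` the constant part. The `K`'s commute, and `[D, D]` has order at most
  -- `m + n - 2j`, below the relevant `m + n - j`.
  have hexp : C m * C n - C n * C m =
      (constPart (C m) (m - j + 1) * (C n - constPart (C n) (n - j + 1)) -
        (C n - constPart (C n) (n - j + 1)) * constPart (C m) (m - j + 1)) -
      (constPart (C n) (n - j + 1) * (C m - constPart (C m) (m - j + 1)) -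
        (C m - constPart (C m) (m - j + 1)) * constPart (C n) (n - j + 1)) +
      ((C m - constPart (C m) (m - j + 1)) * (C n - constPart (C n) (n - j + 1)) -
        (C n - constPart (C n) (n - j + 1)) * (C m - constPart (C m) (m - j + 1))) := by
    generalize constPart (C m) (m - j + 1) = K at *
    generalize constPart (C n) (n - j + 1) = K' at *
    have : C m * C n - C n * C m = C m * C n - C n * C m + (K' * K - K * K') := by
      rw [hKK, sub_self, add_zero]
    rw [this]
    noncomm_ring
  -- At order `m + n - j ≥ max m n` the derivative terms vanish, because the `C`'s are monic.
  have hz := congrArg (fun P : DiffOp A => P.1 s (s + (m + (n - j)))) (hf m n)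
  simp only [hexp] at hz
  rw [add_apply, sub_apply, hC.deriv_apply_eq_zero n m (by omega),
    hC.deriv_apply_eq_zero m n (by omega), add_apply, h₃ s _ (by omega), sub_apply, h₁,
    show (m : ℤ) + (n - j) = n + (m - j) by ring, h₂, sub_constPart_apply_of_lt (by omega),
    sub_constPart_apply_of_lt (by omega), sub_constPart_apply_of_lt (by omega),
    sub_constPart_apply_of_lt (by omega), zero_apply] at hz
  simpa [sub_eq_zero] using hz

theorem exists_gauge_constUpTo_succ {C : ℕ+ → DiffOp A} (hf : IsFlat C) (hC : IsMonic C) {j : ℕ}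
    (hj : 1 ≤ j) (h : ConstUpTo C j) :
    ∃ V : (DiffOp A)ˣ, (V : DiffOp A) - 1 ∈ ordLE A (-j) ∧ ConstUpTo (gauge V C) (j + 1) := by
  obtain ⟨f, hfa⟩ := exists_forall_sub_difference_const
    (fun n s => (C n.toPNat').1 s (s + (n - j))) j (by
      intro m n hm hn s
      have hm' := Nat.toPNat'_coe m
      have hn' := Nat.toPNat'_coe n
      rw [if_pos (by omega)] at hm' hn'
      have := difference_comm_of_isFlat hf hC hj h (m := m.toPNat') (n := n.toPNat')
        (by omega) (by omega) s
      rwa [hm', hn'] at this)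
  -- A gauge `1 + x Λ⁻ʲ + …` adds `x(s + n) - x(s)` at order `n - j`; `x = -f` cancels the
  -- nonconstant part.
  have hX := mono_mem_ordLE (fun s => -f s) (-j : ℤ)
  obtain ⟨V, hV, -⟩ := exists_unit_of_sub_one_mem (P := 1 + mono (fun s => -f s) (-j : ℤ))
    (by rw [add_sub_cancel_left]; exact ordLE_mono (by omega) hX)
  have hV1 : (V : DiffOp A) - 1 = mono (fun s => -f s) (-j : ℤ) := by
    rw [hV, add_sub_cancel_left]
  have hVj : (V : DiffOp A) - 1 ∈ ordLE A (-j) := by rw [hV1]; exact hX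
  refine ⟨V, hVj, fun n i hi hin => ?_⟩
  rcases (Nat.lt_succ_iff.1 hi).lt_or_eq with hi | rfl
  · have hd := gauge_sub_mem_ordLE hC (by exact_mod_cast hj) hVj n
    have e : ∀ s : ℤ, (gauge V C n).1 s (s + (n - i)) = (C n).1 s (s + (n - i)) := fun s => by
      have := hd s (s + (n - i)) (by omega)
      rwa [sub_apply, sub_eq_zero] at this
    intro s
    have e0 := e 0
    rw [zero_add] at e0
    rw [e, e0, h n i hi hin s]
  · have e : ∀ s : ℤ, (gauge V C n).1 s (s + (n - i)) =
        (C n).1 s (s + (n - i)) - (f (s + n) - f s) := fun s => by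
      have := gauge_sub_apply_top hC (by exact_mod_cast hj) hVj n s
      rw [hV1, mono_apply, mono_apply, if_pos (by ring), if_pos (by ring), sub_apply] at this
      rw [sub_eq_iff_eq_add.1 this]
      ring
    intro s
    have e0 := e 0
    have := hfa n hin s
    simp only [PNat.coe_toPNat'] at this
    rw [e s, this, ← e0, zero_add]

/-- A flat monic connection can be gauged so that all coefficients of nonnegative order become
independent of the site. -/
theorem exists_gauge_constAt {C : ℕ+ → DiffOp A} (hf : IsFlat C) (hC : IsMonic C) :
    ∃ W : (DiffOp A)ˣ, (W : DiffOp A) - 1 ∈ ordLE A (-1) ∧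
      ∀ (n : ℕ+) (k : ℤ), 0 ≤ k → ConstAt (gauge W C n) k := by
  obtain ⟨W, hW, hr⟩ := exists_seq_of_step
    (fun i (W : (DiffOp A)ˣ) => (W : DiffOp A) - 1 ∈ ordLE A (-1) ∧
      ConstUpTo (gauge W C) (i + 1))
    (fun i W V => (V : DiffOp A) - W ∈ ordLE A (-i) ∧ (V : DiffOp A) - W ∈ ordLE A (-1)) (a := 1)
    (by
      refine ⟨by rw [Units.val_one, sub_self]; exact zero_mem _, fun n i hi _ s => ?_⟩
      obtain rfl : i = 0 := by omega
      have hone : gauge 1 C n = C n := by simp [gauge, deriv_one]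
      have := hC.top n 0
      rw [zero_add] at this
      simp [hone, hC.top, this])
    (by
      rintro i W ⟨hW, h⟩
      obtain ⟨V, hV, hV'⟩ := exists_gauge_constUpTo_succ (hf.gauge W) (hC.gauge hW)
        (by omega) h
      rw [gauge_gauge] at hV'
      have hWV : ((W * V : (DiffOp A)ˣ) : DiffOp A) - W ∈ ordLE A (-(i + 1 : ℕ)) := by
        have := mul_mem_ordLE (mem_ordLE_zero_of_sub_one_mem hW) hV
        rwa [mul_sub, mul_one, zero_add, ← Units.val_mul] at this
      have h1 : ((W * V : (DiffOp A)ˣ) : DiffOp A) - W ∈ ordLE A (-1) :=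
        ordLE_mono (by omega) hWV
      refine ⟨W * V, ⟨?_, hV'⟩, ordLE_mono (by omega) hWV, h1⟩
      rw [← sub_add_sub_cancel _ (W : DiffOp A)]
      exact add_mem h1 hW)
  obtain ⟨P, hP⟩ := exists_limit (fun i => (W i : DiffOp A)) fun i => (hr i).1
  have hV1 : P - 1 ∈ ordLE A (-1) := by
    rw [← sub_add_sub_cancel _ (W 1 : DiffOp A)]
    exact add_mem (by exact_mod_cast hP 1) (hW 1).1
  obtain ⟨V, rfl, -⟩ := exists_unit_of_sub_one_mem hV1
  have hV' := mem_ordLE_zero_of_sub_one_mem (inv_sub_one_mem_ordLE hV1)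
  refine ⟨V, hV1, fun n k hk => ?_⟩
  -- With this index the gauges by `V` and `W i` differ only in orders at most `-1`, and `W i` has
  -- made all nonnegative orders of the `n`-th operator constant.
  let i : ℕ := n + 1
  have hi := hC.gauge (hW i).1
  have hd : gauge V C n - gauge (W i) C n ∈ ordLE A (n - i) := by
    have e : gauge V C n - gauge (W i) C n = ((V⁻¹ : (DiffOp A)ˣ) : DiffOp A) *
        (C n * (V - W i : DiffOp A) - deriv n (V - W i : DiffOp A) -
          (V - W i : DiffOp A) * gauge (W i) C n) := by
      rw [← Units.mul_right_inj V, Units.mul_inv_cancel_left, mul_sub, mul_gauge, map_sub,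
        sub_mul _ _ (gauge (W i) C n), mul_gauge]
      noncomm_ring
    rw [e]
    have h₁ := mul_mem_ordLE (hC.mem n) (hP i)
    have h₂ := mul_mem_ordLE (hP i) (hi.mem n)
    exact ordLE_mono (by omega) (mul_mem_ordLE hV' (sub_mem (sub_mem h₁
      (ordLE_mono (by omega) (deriv_mem_ordLE (hP i)))) (add_comm (-i : ℤ) n ▸ h₂)))
  have e : ∀ s : ℤ, (gauge V C n).1 s (s + k) = (gauge (W i) C n).1 s (s + k) := fun s => by
    have := hd s (s + k) (by omega)
    rwa [sub_apply, sub_eq_zero] at this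
  intro s
  have e0 := e 0
  rw [zero_add] at e0
  rw [e, e0]
  exact (hW i).2.constAt hi hk (by omega) s

end DiffOp
end ZMatrix

/-! ### Parallel operators and transport back -/

namespace ZMatrix
namespace DiffOp

variable {A : Type*} [CommRing A]

/-- The action `X ↦ ∂X/∂tₙ - [Cₙ, X]` of the connection on operators. -/
noncomputable def lax (C : ℕ+ → DiffOp A) (n : ℕ+) (X : DiffOp A) : DiffOp A :=
  deriv n X - (C n * X - X * C n)

theorem lax_sub (C : ℕ+ → DiffOp A) (n : ℕ+) (X Y : DiffOp A) :
    lax C n (X - Y) = lax C n X - lax C n Y := by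
  simp only [lax, map_sub]
  noncomm_ring

theorem lax_mem_ordLE {C : ℕ+ → DiffOp A} (hC : IsMonic C) (n : ℕ+) {X : DiffOp A} {k : ℤ}
    (hX : X ∈ ordLE A k) : lax C n X ∈ ordLE A (n + k) :=
  sub_mem (ordLE_mono (by omega) (deriv_mem_ordLE hX)) (commutator_mem_ordLE (hC.mem n) hX)

/-- The commutator of the two actions is bracketing with the curvature, by the Jacobi identity. -/
theorem lax_comm {C : ℕ+ → DiffOp A} (hf : IsFlat C) (m n : ℕ+) (X : DiffOp A) :
    lax C m (lax C n X) = lax C n (lax C m X) := by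
  have h : deriv m (C n) = deriv n (C m) - (C n * C m - C m * C n) := by
    have := hf n m
    rw [add_eq_zero_iff_eq_neg, sub_eq_iff_eq_add] at this
    rw [this]
    abel
  simp only [lax, map_sub, deriv_mul, h, deriv_comm m n]
  noncomm_ring

/-- The nonnegative part of `C n` commutes with `Y`, so only the part of order at most `-1` acts. -/
theorem commutator_mem_ordLE_of_isConst {C : ℕ+ → DiffOp A}
    (hc : ∀ (n : ℕ+) (k : ℤ), 0 ≤ k → ConstAt (C n) k) (n : ℕ+) {Y : DiffOp A} {k : ℤ}
    (hY : IsConst Y) (hYk : Y ∈ ordLE A k) : C n * Y - Y * C n ∈ ordLE A (k - 1) := by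
  have h := commutator_mem_ordLE (sub_constPart_mem_ordLE (r := -1) (by norm_num) (hc n)) hYk
  have e : (C n - constPart (C n) 0) * Y - Y * (C n - constPart (C n) 0) = C n * Y - Y * C n := by
    rw [sub_mul, mul_sub, (isConst_constPart (C n) 0).mul_comm hY]
    abel
  rw [e] at h
  exact ordLE_mono (by omega) h

theorem isConst_lax {C : ℕ+ → DiffOp A} (hC : IsMonic C)
    (hc : ∀ (n : ℕ+) (k : ℤ), 0 ≤ k → ConstAt (C n) k) (hf : IsFlat C) {X : DiffOp A}
    (hX : ∀ n, lax C n X ∈ ordLE A 0) (n : ℕ+) :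
    IsConst (lax C n X) := by
  refine isConst_of_commutator_mem_ordLE (c := fun m => constPart (C m) 0) (n := n)
    (fun m => isConst_constPart _ _) (fun m => constPart_mem_ordLE (hC.mem m) _) (fun m s => ?_)
    fun m => ?_
  · have := hC.top m 0
    rw [zero_add] at this
    rw [constPart_apply_of_le (by omega), this]
  · have h₁ := commutator_mem_ordLE
      (sub_constPart_mem_ordLE (P := C m) (q := 0) (r := -1) (by norm_num) (hc m)) (hX n)
    have h₂ := lax_mem_ordLE hC n (hX m)
    -- After the interchange the order is bounded by `n`, uniformly in `m`.
    rw [lax_comm hf] at h₂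
    have h₃ : deriv m (lax C n X) ∈ ordLE A 0 := deriv_mem_ordLE (hX n)
    have e : constPart (C m) 0 * lax C n X - lax C n X * constPart (C m) 0 =
        deriv m (lax C n X) - lax C m (lax C n X) -
          ((C m - constPart (C m) 0) * lax C n X - lax C n X * (C m - constPart (C m) 0)) := by
      rw [lax.eq_1 C m]
      noncomm_ring
    have hn := n.pos
    rw [e]
    exact sub_mem (sub_mem (ordLE_mono (by omega) h₃) (ordLE_mono (by omega) h₂))
      (ordLE_mono (by omega) h₁)

theorem exists_lax_mem_ordLE_succ [Algebra ℂ A] {C : ℕ+ → DiffOp A} (hC : IsMonic C)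
    (hc : ∀ (n : ℕ+) (k : ℤ), 0 ≤ k → ConstAt (C n) k) (hf : IsFlat C) {X : DiffOp A}
    (hX : IsConst X) {i : ℕ} (hXi : ∀ n, lax C n X ∈ ordLE A (-i)) :
    ∃ X' : DiffOp A, IsConst X' ∧ X' - X ∈ ordLE A (-i) ∧
      ∀ n, lax C n X' ∈ ordLE A (-(i + 1 : ℕ)) := by
  have hY := isConst_lax hC hc hf fun n => ordLE_mono (by omega) (hXi n)
  -- The bracket with `C m` lowers the order, so on leading coefficients the action is plain
  -- differentiation; `lax_comm` then becomes closedness.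
  have hlead : ∀ m n, (lax C m (lax C n X)).1 0 (-i) =
      MvPowerSeries.pderiv A m ((lax C n X).1 0 (-i)) := fun m n => by
    rw [lax.eq_1 C m, sub_apply,
      commutator_mem_ordLE_of_isConst hc m (hY n) (hXi n) 0 (-i) (by omega), sub_zero, deriv_apply]
  obtain ⟨ρ, hρ⟩ := exists_forall_pderiv_eq (fun n => (lax C n X).1 0 (-i)) fun m n => by
    rw [← hlead, ← hlead, lax_comm hf]
  have hm := mono_mem_ordLE (fun _ => ρ) (-i : ℤ)
  have hcm := isConst_mono ρ (-i : ℤ)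
  refine ⟨X - mono (fun _ => ρ) (-i), hX.sub hcm, ?_, fun n => ?_⟩
  · rw [sub_sub_cancel_left]
    exact neg_mem hm
  · have h₁ := commutator_mem_ordLE_of_isConst hc n hcm hm
    have h₂ : lax C n X - deriv n (mono (fun _ => ρ) (-i : ℤ)) ∈ ordLE A (-i - 1) := by
      intro μ ν h
      rcases (show (-i : ℤ) ≤ ν - μ by omega).eq_or_lt with h | h
      · rw [sub_apply, hY n, ← h, deriv_apply, mono_apply, if_pos (by omega), hρ, sub_self]
      · exact sub_mem (hXi n) (deriv_mem_ordLE hm) μ ν h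
    rw [lax_sub, lax.eq_1 C n (mono _ _), ← sub_add]
    exact ordLE_mono (by omega) (add_mem h₂ h₁)

/-- A flat connection whose nonnegative part commutes with `Λ` leaves a constant operator
`Λ + O(1)` invariant. -/
theorem exists_lax_eq_zero [Algebra ℂ A] {C : ℕ+ → DiffOp A} (hC : IsMonic C)
    (hc : ∀ (n : ℕ+) (k : ℤ), 0 ≤ k → ConstAt (C n) k) (hf : IsFlat C) :
    ∃ X : DiffOp A, X - mono (fun _ => 1) 1 ∈ ordLE A 0 ∧ ∀ n, lax C n X = 0 := by
  have hΛ := mono_mem_ordLE (A := A) (fun _ => 1) 1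
  have hcΛ := isConst_mono (A := A) 1 1
  obtain ⟨X, hX, hr⟩ := exists_seq_of_step
    (fun i (X : DiffOp A) => IsConst X ∧
      X - mono (fun _ => 1) 1 ∈ ordLE A 0 ∧ ∀ n, lax C n X ∈ ordLE A (-i))
    (fun i X X' => X' - X ∈ ordLE A (-i)) (a := mono (fun _ => 1) 1)
    (by
      refine ⟨hcΛ, by rw [sub_self]; exact zero_mem _, fun n => ?_⟩
      have hd : deriv n (mono (fun _ => 1) 1 : DiffOp A) = 0 := by
        refine ext fun μ ν => ?_
        rw [deriv_apply, mono_apply, zero_apply]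
        split_ifs
        · exact Derivation.map_one_eq_zero _
        · exact map_zero _
      rw [lax, hd, zero_sub]
      exact neg_mem (commutator_mem_ordLE_of_isConst hc n hcΛ hΛ))
    (fun i X hX => by
      obtain ⟨X', h, h', h''⟩ := exists_lax_mem_ordLE_succ hC hc hf hX.1 hX.2.2
      refine ⟨X', ⟨h, ?_, h''⟩, h'⟩
      rw [← sub_add_sub_cancel _ X]
      exact add_mem (ordLE_mono (by omega) h') hX.2.1)
  obtain ⟨Y, hY⟩ := exists_limit X hr
  refine ⟨Y, ?_, fun n => ?_⟩
  · rw [← sub_add_sub_cancel _ (X 0)]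
    exact add_mem (ordLE_mono (by omega) (hY 0)) (hX 0).2.1
  · refine eq_zero_of_forall_mem_ordLE n fun i => ?_
    have h := lax_mem_ordLE hC n (hY i)
    rw [lax_sub] at h
    rw [← sub_add_cancel (lax C n Y) (lax C n (X i))]
    exact add_mem h (ordLE_mono (by omega) ((hX i).2.2 n))

/-- Transport of an invariant operator along a gauge transformation. -/
theorem lax_conj_eq_zero {C : ℕ+ → DiffOp A} (W : (DiffOp A)ˣ) {n : ℕ+} {X : DiffOp A}
    (hX : lax (gauge W C) n X = 0) :
    lax C n (W * X * ((W⁻¹ : (DiffOp A)ˣ) : DiffOp A)) = 0 := by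
  obtain ⟨L, hL⟩ : ∃ L, L = W * X * ((W⁻¹ : (DiffOp A)ˣ) : DiffOp A) := ⟨_, rfl⟩
  rw [← hL]
  have hLW : L * W = W * X := by rw [hL, Units.inv_mul_cancel_right]
  have hd := congrArg (deriv n) hLW
  rw [lax, sub_eq_zero] at hX
  rw [deriv_mul n L, deriv_mul, hX, deriv_eq_mul_gauge W C n, ← eq_sub_iff_add_eq] at hd
  rw [← Units.mul_left_eq_zero W, lax, sub_mul, hd]
  have h₁ : C n * L * W = C n * W * X := by rw [mul_assoc, hLW, mul_assoc]
  have h₂ : L * (W * gauge W C n) = W * X * gauge W C n := by rw [← mul_assoc, hLW]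
  rw [sub_mul (C n * L), h₁, mul_sub L, h₂]
  noncomm_ring

theorem conj_mem_ordLE {W : (DiffOp A)ˣ} (hW : (W : DiffOp A) - 1 ∈ ordLE A (-1)) {X : DiffOp A}
    {k : ℤ} (hX : X ∈ ordLE A k) :
    W * X * ((W⁻¹ : (DiffOp A)ˣ) : DiffOp A) ∈ ordLE A k := by
  have := mul_mem_ordLE (mul_mem_ordLE (mem_ordLE_zero_of_sub_one_mem hW) hX)
    (mem_ordLE_zero_of_sub_one_mem (inv_sub_one_mem_ordLE hW))
  rwa [zero_add, add_zero] at this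

theorem conj_apply_top {W : (DiffOp A)ˣ} (hW : (W : DiffOp A) - 1 ∈ ordLE A (-1)) {X : DiffOp A}
    {k : ℤ} (hX : X ∈ ordLE A k) (s : ℤ) :
    (W * X * ((W⁻¹ : (DiffOp A)ˣ) : DiffOp A)).1 s (s + k) = X.1 s (s + k) := by
  have hW' := inv_sub_one_mem_ordLE hW
  have hW0 := mem_ordLE_zero_of_sub_one_mem hW
  have h := mul_apply_top (mul_mem_ordLE hW0 hX) (mem_ordLE_zero_of_sub_one_mem hW') s
  rw [mul_apply_top hW0 hX, apply_self_of_sub_one_mem hW, apply_self_of_sub_one_mem hW', one_mul,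
    mul_one] at h
  simpa using h

end DiffOp
end ZMatrix

/-! ### The theorem -/

open ZMatrix DiffOp in
theorem mainTheorem4 {A : Type*} [CommRing A] [Algebra ℂ A]
    (b : ℕ+ → ℕ → ℤ → TimeSeries A) (B : ℕ+ → ZMatrix A)
    (hb : ∀ (n : ℕ+) (s : ℤ), b n n s = 1)
    (hB : ∀ n : ℕ+,
      B n = ∑ j ∈ Finset.range ((n : ℕ) + 1), ZMatrix.diagShift (b n j) (j : ℤ))
    (hZS : ∀ m n : ℕ+,
      ZMatrix.timeDeriv n (B m) - ZMatrix.timeDeriv m (B n) + ZMatrix.comm (B m) (B n) = 0) :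
    ∃ (u : ℤ → ℤ → TimeSeries A) (L : ZMatrix A),
      (∀ s : ℤ, u 1 s = 1) ∧ L = ZMatrix.lowerSeries 1 u ∧
        ∀ n : ℕ+, ZMatrix.timeDeriv n L - ZMatrix.comm (B n) L = 0 := by
  have hB' : ∀ (n : ℕ+) (μ ν : ℤ), B n μ ν =
      ∑ j ∈ Finset.range ((n : ℕ) + 1), if μ + (j : ℤ) = ν then b n j μ else 0 := fun n μ ν => by
    rw [hB, Matrix.sum_apply]
    rfl
  have hB0 : ∀ (n : ℕ+) (μ ν : ℤ), (n : ℤ) < ν - μ → B n μ ν = 0 := fun n μ ν h => by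
    rw [hB']
    refine Finset.sum_eq_zero fun j hj => if_neg ?_
    rw [Finset.mem_range] at hj
    omega
  let C : ℕ+ → DiffOp A := fun n => ⟨B n, n, hB0 n⟩
  have hC : IsMonic C := ⟨hB0, fun n s => by
    change B n s (s + n) = 1
    rw [hB', Finset.sum_eq_single (n : ℕ), if_pos rfl, hb]
    · exact fun j _ hj => if_neg (by omega)
    · simp⟩
  have hf : IsFlat C := fun m n => ext fun μ ν => by
    have := congrFun (congrFun (hZS m n) μ) ν
    rw [DiffOp.add_apply, DiffOp.sub_apply, DiffOp.sub_apply]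
    exact this
  obtain ⟨W, hW, hWC⟩ := exists_gauge_constAt hf hC
  obtain ⟨X, hX, hXL⟩ := exists_lax_eq_zero (hC.gauge hW) hWC (hf.gauge W)
  have hX1 : X ∈ ordLE A 1 := by
    have := add_mem (ordLE_mono (by norm_num) hX) (mono_mem_ordLE (fun _ => 1) 1)
    rwa [sub_add_cancel] at this
  let L : DiffOp A := W * X * ((W⁻¹ : (DiffOp A)ˣ) : DiffOp A)
  refine ⟨fun k s => L.1 s (s + k), L.1, fun s => ?_, ?_, fun n => ?_⟩
  · have := hX s (s + 1) (by omega)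
    rw [DiffOp.sub_apply, mono_apply, if_pos rfl, sub_eq_zero] at this
    exact (conj_apply_top hW hX1 s).trans this
  · ext1 μ ν
    change L.1 μ ν = if ν - μ ≤ 1 then L.1 μ (μ + (ν - μ)) else 0
    split_ifs with h
    · rw [add_sub_cancel]
    · exact conj_mem_ordLE hW hX1 μ ν (by omega)
  · have h := lax_conj_eq_zero W (hXL n)
    ext1 μ ν
    have := congrArg (fun P : DiffOp A => P.1 μ ν) h
    simp only [lax] at this
    rw [DiffOp.sub_apply, DiffOp.sub_apply] at this
    exact this
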